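/- Consider marriage markets with $n$ women $w_1,\dots,w_n$ and $n$ men $m_1,\dots,m_n$. Each woman has a strict total preference order over all men, and each man one over all women. A perfect marriage is a bijection between women and men; it is stable if no woman and man prefer each other over their spouses. Alice holds the preference lists of all women and Bob those of all men. Let $R(x,y,z)$ be a search problem ("$z$ is a correct output on the input $(x,y)$"). For $\frac12<p\le 1$, its randomized communication complexity with success probability $p$ is the least worst-case number of bits exchanged, over all inputs and all coin outcomes, by a two-party public-coin protocol which, on every fixed input that has a correct output, produces a correct output with probability at least $p$ (the usual choice is $p=\frac23$). Let $0<\varepsilon\le 1$ and $\frac12<p\le 1$ be fixed. Then, as $n\to\infty$, the randomized communication complexity with success probability $p$ of each of the following two search problems is $\Omega(n^2)$: 1. output a set of at least $\varepsilon n$ pairs $(w,m)$, each of which is contained in some stable marriage; 2. output a set of at least $\varepsilon n$ pairs $(w,m)$, each of which is contained in every stable marriage. That is, for each of the two problems there are $c>0$ and $N$, depending only on $\varepsilon$ and $p$, such that for all $n\ge N$ the complexity is at least $c\,n^2$. -/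

import Mathlib

open scoped ENNReal

namespace StableMarriage

/-! ### Marriage markets with full preference lists -/

/-- A full preference list over `A`: a strict total order on `A`, where `prefers a b` says that
`a` precedes `b` on the list. -/
structure PrefList (A : Type) where
  prefers : A → A → Prop
  isStrictTotalOrder : IsStrictTotalOrder A prefers

/-- A profile of full preference lists for `A` over `B`: one list over `B` for each `a : A`. -/
abbrev Profile (A B : Type) : Type := A → PrefList B

/-- `(w, m)` is a blocking pair for the perfect marriage `μ`: each of `w`, `m` prefers the other
over their spouse in `μ`. -/
def IsBlockingPair {W M : Type} (PW : Profile W M) (PM : Profile M W) (μ : W ≃ M)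
    (w : W) (m : M) : Prop :=
  (PW w).prefers m (μ w) ∧ (PM m).prefers w (μ.symm m)

/-- A perfect marriage is stable if it has no blocking pair. -/
def IsStable {W M : Type} (PW : Profile W M) (PM : Profile M W) (μ : W ≃ M) : Prop :=
  ∀ w m, ¬ IsBlockingPair PW PM μ w m

/-- The pair is contained in some stable marriage. -/
def InSomeStable {W M : Type} (PW : Profile W M) (PM : Profile M W) (q : W × M) : Prop :=
  ∃ μ : W ≃ M, IsStable PW PM μ ∧ μ q.1 = q.2

/-- The pair is contained in every stable marriage. -/
def InEveryStable {W M : Type} (PW : Profile W M) (PM : Profile M W) (q : W × M) : Prop :=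
  ∀ μ : W ≃ M, IsStable PW PM μ → μ q.1 = q.2

/-! ### Two-party communication -/

/-- A deterministic two-party protocol tree: Alice holds a value in `X`, Bob a value in `Y`. At an
inner node its owner sends one bit, computed from the owner's own input, and the protocol continues
in the first subtree (bit `false`) or in the second one (bit `true`). A leaf carries the output. -/
inductive Protocol (X Y Z : Type) : Type where
  | output (z : Z) : Protocol X Y Z
  | alice (f : X → Bool) (p₀ p₁ : Protocol X Y Z) : Protocol X Y Z
  | bob (g : Y → Bool) (p₀ p₁ : Protocol X Y Z) : Protocol X Y Z

namespace Protocol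

variable {X Y Z : Type}

/-- The output of the protocol on the input `(x, y)`. -/
def run : Protocol X Y Z → X → Y → Z
  | output z, _, _ => z
  | alice f p₀ p₁, x, y => bif f x then p₁.run x y else p₀.run x y
  | bob g p₀ p₁, x, y => bif g y then p₁.run x y else p₀.run x y

/-- The number of bits exchanged on the input `(x, y)`. -/
def bits : Protocol X Y Z → X → Y → ℕ
  | output _, _, _ => 0
  | alice f p₀ p₁, x, y => (bif f x then p₁.bits x y else p₀.bits x y) + 1
  | bob g p₀ p₁, x, y => (bif g y then p₁.bits x y else p₀.bits x y) + 1

end Protocol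

/-- A randomized protocol (with public coins, which can simulate private ones): a probability
distribution over deterministic protocols. -/
abbrev RandProtocol (X Y Z : Type) : Type := PMF (Protocol X Y Z)

namespace RandProtocol

variable {X Y Z : Type}

/-- The communication cost: the number of bits exchanged in the worst case, over all inputs and all
outcomes of the coins. -/
noncomputable def cost (P : RandProtocol X Y Z) : ℕ∞ :=
  ⨆ π ∈ P.support, ⨆ x : X, ⨆ y : Y, (π.bits x y : ℕ∞)

/-- `P` solves the search problem `R` with success probability at least `p`: on every fixed input
that has a correct output at all, the output is correct with probability at least `p`. -/
def Solves (P : RandProtocol X Y Z) (p : ℝ) (R : X → Y → Z → Prop) : Prop :=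
  ∀ x y, (∃ z, R x y z) → ENNReal.ofReal p ≤ P.toOuterMeasure {π | R x y (π.run x y)}

end RandProtocol

/-- The randomized communication complexity, with success probability `p`, of the search problem
`R`: the lowest communication cost of a randomized protocol for it. -/
noncomputable def randCC {X Y Z : Type} (p : ℝ) (R : X → Y → Z → Prop) : ℕ∞ :=
  ⨅ P : RandProtocol X Y Z, ⨅ _ : P.Solves p R, P.cost

/-! ### Finding stable couples -/

/-- The task of finding (at least) `ε * n` pairs, each of which is contained in some stable
marriage. -/
def FindSome (ε : ℝ) (n : ℕ) (PW PM : Profile (Fin n) (Fin n)) (S : Finset (Fin n × Fin n)) :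
    Prop :=
  ε * n ≤ (S.card : ℝ) ∧ ∀ q ∈ S, InSomeStable PW PM q

/-- The task of finding (at least) `ε * n` pairs, each of which is contained in every stable
marriage. -/
def FindEvery (ε : ℝ) (n : ℕ) (PW PM : Profile (Fin n) (Fin n)) (S : Finset (Fin n × Fin n)) :
    Prop :=
  ε * n ≤ (S.card : ℝ) ∧ ∀ q ∈ S, InEveryStable PW PM q

end StableMarriage

/-! The proof embeds unique disjointness on a `k × k` grid, with `k` about `ε n / 4`, into a market.
If Alice's and Bob's sets are disjoint, the only stable marriage is the default one
(`ClassStable.eq_refl`). If they meet in exactly one point, that point creates one new couple, whose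
abandoned partners push a long chain of agents off all their default partners, and the result is
again the only stable marriage (`ClassStable.eq_shift`). Fewer than `ε n` default couples lie
outside the chain, so every correct output contains a default chain couple in the first case and
none in the second. As the stable marriage is unique, both tasks ask for the same pairs.

Unique disjointness on `ι` costs a constant times `|ι|` bits (`le_cost`). Split a uniform set `z`
along a uniform set `S` between the players. With few transcripts, most fibres of the transcript map
are large subsets of the cube, hence nearly balanced in most coordinates (`level_one`): giving one
player one more element hardly moves the transcript in Hellinger distance (`hell_split`). By the
rectangle property, giving the same element to both players hardly moves it either (`hell_both_le`),
so the disjoint and the uniquely intersecting inputs look alike. -/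

namespace StableMarriage

/-! ### Transcripts of deterministic protocols and their rectangles -/

namespace Protocol

variable {X Y Z : Type}

/-- The transcript of the protocol on the input `(x, y)`, encoded as a number below `2 ^ bits`. -/
def code : Protocol X Y Z → X → Y → ℕ
  | output _, _, _ => 0
  | alice f p₀ p₁, x, y => bif f x then 2 * p₁.code x y + 1 else 2 * p₀.code x y
  | bob g p₀ p₁, x, y => bif g y then 2 * p₁.code x y + 1 else 2 * p₀.code x y

theorem code_lt (π : Protocol X Y Z) (x : X) (y : Y) : π.code x y < 2 ^ π.bits x y := by
  induction π with
  | output z => simp [code, bits]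
  | alice f p₀ p₁ h₀ h₁ =>
    cases h : f x <;> simp only [code, bits, h, cond_true, cond_false, pow_succ] <;> omega
  | bob g p₀ p₁ h₀ h₁ =>
    cases h : g y <;> simp only [code, bits, h, cond_true, cond_false, pow_succ] <;> omega

/-- The output is a function of the transcript. -/
theorem run_eq_of_code_eq (π : Protocol X Y Z) {x x' : X} {y y' : Y}
    (h : π.code x y = π.code x' y') : π.run x y = π.run x' y' := by
  induction π with
  | output z => rfl
  | alice f p₀ p₁ h₀ h₁ =>
    cases hx : f x <;> cases hx' : f x' <;>
      simp only [code, run, hx, hx', cond_true, cond_false] at h ⊢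
    · exact h₀ (by omega)
    · omega
    · omega
    · exact h₁ (by omega)
  | bob g p₀ p₁ h₀ h₁ =>
    cases hx : g y <;> cases hx' : g y' <;>
      simp only [code, run, hx, hx', cond_true, cond_false] at h ⊢
    · exact h₀ (by omega)
    · omega
    · omega
    · exact h₁ (by omega)

/-- The inputs with a given transcript form a rectangle. -/
theorem code_cross (π : Protocol X Y Z) {x x' : X} {y y' : Y}
    (h : π.code x y = π.code x' y') : π.code x y' = π.code x y := by
  induction π with
  | output z => rfl
  | alice f p₀ p₁ h₀ h₁ =>
    cases hx : f x <;> cases hx' : f x' <;>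
      simp only [code, hx, hx', cond_true, cond_false] at h ⊢
    · rw [h₀ (by omega)]
    · omega
    · omega
    · rw [h₁ (by omega)]
  | bob g p₀ p₁ h₀ h₁ =>
    cases hx : g y <;> cases hx' : g y' <;>
      simp only [code, hx, hx', cond_true, cond_false] at h ⊢
    · rw [h₀ (by omega)]
    · omega
    · omega
    · rw [h₁ (by omega)]

end Protocol

/-! ### Unique disjointness -/

/-! ### Balance of large subsets of the cube, and entropy -/

section Cube

open Finset

variable {ι : Type} [Fintype ι] [DecidableEq ι]

theorem sum_exp_signs (b : ι → ℝ) :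
    ∑ z : Finset ι, Real.exp (∑ i, b i * (if i ∈ z then -1 else 1)) =
      ∏ i, (2 * Real.cosh (b i)) := by
  have h : ∀ i, 2 * Real.cosh (b i) = Real.exp (-b i) + Real.exp (b i) := by
    intro i; rw [Real.cosh_eq]; ring
  simp_rw [h]
  rw [Fintype.prod_add]
  refine Finset.sum_congr rfl fun z _ => ?_
  rw [Real.exp_sum]
  rw [← Finset.prod_mul_prod_compl z]
  congr 1
  · refine Finset.prod_congr rfl fun i hi => ?_
    simp [hi]
  · refine Finset.prod_congr rfl fun i hi => ?_
    simp [Finset.mem_compl.1 hi]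

/-- The level-one inequality: the squared biases of the coordinates of a uniformly random element
of a large subset of the cube have a small sum. -/
theorem level_one (P : Finset (Finset ι)) (hP : P.Nonempty) (b : ι → ℝ)
    (hb : ∀ i, b i * #P = ∑ z ∈ P, (if i ∈ z then -1 else 1 : ℝ)) :
    ∑ i, b i ^ 2 ≤ 2 * Real.log (2 ^ Fintype.card ι / #P) := by
  set B := ∑ i, b i ^ 2 with hB
  have hc : (0 : ℝ) < #P := by exact_mod_cast hP.card_pos
  set u : Finset ι → ℝ := fun z => ∑ i, b i * (if i ∈ z then -1 else 1) with hu
  have hmean : ∑ z ∈ P, u z = #P * B := by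
    simp only [hu]
    rw [Finset.sum_comm, hB, Finset.mul_sum]
    refine Finset.sum_congr rfl fun i _ => ?_
    rw [← Finset.mul_sum, ← hb]; ring
  -- Jensen's inequality through the tangent of `exp` at `B`, the mean of `u` over `P`.
  have h1 : #P * Real.exp B ≤ ∑ z ∈ P, Real.exp (u z) := by
    have : ∀ z ∈ P, Real.exp B * (1 + u z - B) ≤ Real.exp (u z) := by
      intro z _
      have h := Real.add_one_le_exp (u z - B)
      calc _ ≤ Real.exp B * Real.exp (u z - B) := by gcongr; linarith
        _ = _ := by rw [← Real.exp_add]; ring_nf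
    refine le_trans (le_of_eq ?_) (Finset.sum_le_sum this)
    rw [← Finset.mul_sum, Finset.sum_sub_distrib, Finset.sum_add_distrib, hmean]
    simp; ring
  -- Over the whole cube the signs are independent, which yields a subgaussian bound with `B / 2` in
  -- place of `B`; comparing with `h1` bounds `B`.
  have h2 : ∑ z ∈ P, Real.exp (u z) ≤ 2 ^ Fintype.card ι * Real.exp (B / 2) := by
    calc _ ≤ ∑ z, Real.exp (u z) :=
          Finset.sum_le_sum_of_subset_of_nonneg (Finset.subset_univ _)
            fun _ _ _ => (Real.exp_pos _).le
      _ = ∏ i, (2 * Real.cosh (b i)) := sum_exp_signs b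
      _ ≤ ∏ i, (2 * Real.exp (b i ^ 2 / 2)) := by
          refine Finset.prod_le_prod (fun i _ => by positivity) fun i _ => ?_
          gcongr
          exact Real.cosh_le_exp_half_sq _
      _ = _ := by
          rw [Finset.prod_mul_distrib, ← Real.exp_sum, ← Finset.sum_div]
          simp [hB, Finset.card_univ]
  have h3 : Real.exp (B / 2) ≤ 2 ^ Fintype.card ι / #P := by
    rw [le_div_iff₀ hc]
    have h := h1.trans h2
    have e : Real.exp B = Real.exp (B / 2) * Real.exp (B / 2) := by
      rw [← Real.exp_add]; ring_nf
    rw [e] at h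
    have := Real.exp_pos (B / 2)
    nlinarith
  have := (Real.le_log_iff_exp_le (by positivity)).2 h3
  linarith

/-- Follows from `a + b ≤ (√a + √b) ^ 2`. It turns squared biases into Hellinger terms. -/
theorem sq_sqrt_sub_sqrt_mul_le {a b : ℝ} (ha : 0 ≤ a) (hb : 0 ≤ b) :
    (√a - √b) ^ 2 * (a + b) ≤ (a - b) ^ 2 := by
  have h1 := Real.sq_sqrt ha
  have h2 := Real.sq_sqrt hb
  have h3 := Real.sqrt_nonneg a
  have h4 := Real.sqrt_nonneg b
  have : (a - b) ^ 2 = (√a - √b) ^ 2 * (√a + √b) ^ 2 := by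
    rw [← mul_pow, mul_comm (√a - √b), ← sq_sub_sq, h1, h2]
  rw [this]
  gcongr
  nlinarith [mul_nonneg h3 h4]

/-- A large subset of the cube has few coordinates in which it is unbalanced. -/
theorem sum_sqrt_sub_sqrt_le (P : Finset (Finset ι)) :
    ∑ i, (√(#{z ∈ P | i ∉ z} : ℝ) - √(#{z ∈ P | i ∈ z} : ℝ)) ^ 2 ≤
      2 * (#P * Real.log (2 ^ Fintype.card ι / #P)) := by
  rcases P.eq_empty_or_nonempty with rfl | hP
  · simp
  have hc : (0 : ℝ) < #P := by exact_mod_cast hP.card_pos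
  have hs : ∀ i, (#{z ∈ P | i ∉ z} : ℝ) + #{z ∈ P | i ∈ z} = #P := by
    intro i
    rw [add_comm]
    exact_mod_cast Finset.card_filter_add_card_filter_not (s := P) (fun z => i ∈ z)
  have hd : ∀ i, (#{z ∈ P | i ∉ z} : ℝ) - #{z ∈ P | i ∈ z} =
      ∑ z ∈ P, (if i ∈ z then -1 else 1 : ℝ) := by
    intro i
    rw [Finset.sum_ite]
    simp; ring
  have h := level_one P hP
    (fun i => ((#{z ∈ P | i ∉ z} : ℝ) - #{z ∈ P | i ∈ z}) / #P) (fun i => by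
      rw [← hd]; field_simp)
  calc _ ≤ ∑ i, #P * (((#{z ∈ P | i ∉ z} : ℝ) - #{z ∈ P | i ∈ z}) / #P) ^ 2 := by
        refine Finset.sum_le_sum fun i _ => ?_
        have := sq_sqrt_sub_sqrt_mul_le (a := (#{z ∈ P | i ∉ z} : ℝ))
          (b := (#{z ∈ P | i ∈ z} : ℝ)) (by positivity) (by positivity)
        rw [hs] at this
        rw [div_pow, pow_two (#P : ℝ), ← mul_div_assoc, mul_div_mul_left _ _ hc.ne',
          le_div_iff₀ hc]
        exact this
    _ ≤ _ := by
        rw [← Finset.mul_sum]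
        calc _ ≤ (#P : ℝ) * _ := mul_le_mul_of_nonneg_left h hc.le
          _ = _ := by ring

/-- The entropy of a partition is at most the logarithm of the number of its parts. -/
theorem sum_mul_log_div_le {T : Type} [Fintype T] [Nonempty T] (d : T → ℝ) (hd : ∀ t, 0 ≤ d t)
    {D : ℝ} (hD : ∑ t, d t = D) (hD₀ : 0 < D) :
    ∑ t, d t * Real.log (D / d t) ≤ D * Real.log (Fintype.card T) := by
  have hM : (0 : ℝ) < Fintype.card T := by exact_mod_cast Fintype.card_pos
  -- Gibbs' inequality against the uniform distribution, termwise from `log s ≤ s - 1`; the two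
  -- correction terms cancel in the sum.
  have : ∀ t, d t * Real.log (D / d t) ≤
      d t * Real.log (Fintype.card T) + D / Fintype.card T - d t := by
    intro t
    rcases (hd t).eq_or_lt with h | h
    · rw [← h]; simp; positivity
    · have h1 : D / d t = Fintype.card T * (D / (Fintype.card T * d t)) := by field_simp
      have h2 := Real.log_le_sub_one_of_pos (x := D / (Fintype.card T * d t)) (by positivity)
      rw [h1, Real.log_mul hM.ne' (by positivity), mul_add]
      have h3 : d t * Real.log (D / (Fintype.card T * d t)) ≤
          d t * (D / (Fintype.card T * d t) - 1) := by gcongr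
      have h4 : d t * (D / (Fintype.card T * d t) - 1) = D / Fintype.card T - d t := by
        field_simp
      linarith
  refine (Finset.sum_le_sum fun t _ => this t).trans (le_of_eq ?_)
  rw [Finset.sum_sub_distrib, Finset.sum_add_distrib, ← Finset.sum_mul, hD]
  simp [Finset.card_univ]
  field_simp
  ring

end Cube

/-! ### Hellinger distance of transcripts and cut and paste -/

section UniqueDisjointness

open Finset

variable {ι : Type} [Fintype ι] [DecidableEq ι] {T : Type} [DecidableEq T]

/-- The sets `z` without `i` such that the transcript is `t` when `z` is split along `S` between
Alice and Bob and they moreover add `a` and `b`, respectively, to their shares. -/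
def slice (τ : Finset ι → Finset ι → T) (S : Finset ι) (i : ι) (a b : Finset ι) (t : T) :
    Finset (Finset ι) :=
  {z | i ∉ z ∧ τ (z ∩ S ∪ a) (z \ S ∪ b) = t}

variable {τ : Finset ι → Finset ι → T}

theorem mem_slice {S : Finset ι} {i : ι} {a b : Finset ι} {t : T} {z : Finset ι} :
    z ∈ slice τ S i a b t ↔ i ∉ z ∧ τ (z ∩ S ∪ a) (z \ S ∪ b) = t := by
  simp [slice]

/-- Exchanging the parts outside `S` of two sets swaps Bob's inputs. The rectangle property keeps
the transcript, and the exchange can be undone. Since `b` and `b'` are arbitrary, the reverse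
inequality is another instance. -/
theorem card_slice_mul_le (hτ : ∀ x y x' y', τ x y = τ x' y' → τ x y' = τ x y)
    (S : Finset ι) (i : ι) (a b a' b' : Finset ι) (t : T) :
    #(slice τ S i a b t) * #(slice τ S i a' b' t) ≤
      #(slice τ S i a b' t) * #(slice τ S i a' b t) := by
  rw [← Finset.card_product, ← Finset.card_product]
  refine Finset.card_le_card_of_injOn
    (fun w => ((w.1 ∩ S) ∪ (w.2 \ S), (w.2 ∩ S) ∪ (w.1 \ S))) ?_ ?_
  · rintro ⟨z, z'⟩ h
    simp only [Finset.coe_product, Set.mem_prod, Finset.mem_coe, mem_slice] at h ⊢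
    obtain ⟨⟨h1, h2⟩, h3, h4⟩ := h
    have e1 : ∀ u v : Finset ι, (u ∩ S ∪ v \ S) ∩ S = u ∩ S := by
      intro u v; ext j; simp; tauto
    have e2 : ∀ u v : Finset ι, (u ∩ S ∪ v \ S) \ S = v \ S := by
      intro u v; ext j; simp; tauto
    simp only [e1, e2]
    refine ⟨⟨?_, ?_⟩, ?_, ?_⟩
    · simp [h1, h3]
    · rw [← h2]; exact hτ _ _ _ _ (h2.trans h4.symm)
    · simp [h1, h3]
    · rw [← h4]; exact hτ _ _ _ _ (h4.trans h2.symm)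
  · rintro ⟨z, z'⟩ _ ⟨w, w'⟩ _ h
    simp only [Prod.mk.injEq] at h
    obtain ⟨h1, h2⟩ := h
    simp only [Finset.ext_iff, Finset.mem_union, Finset.mem_inter, Finset.mem_sdiff] at h1 h2
    simp only [Prod.mk.injEq]
    constructor <;> ext j <;> have a1 := h1 j <;> have a2 := h2 j <;> clear h1 h2 hτ <;>
      by_cases hj : j ∈ S <;> simp [hj] at a1 a2 <;> assumption

/-- Cut and paste for the rectangles of a protocol. -/
theorem card_slice_mul (hτ : ∀ x y x' y', τ x y = τ x' y' → τ x y' = τ x y)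
    (S : Finset ι) (i : ι) (a b a' b' : Finset ι) (t : T) :
    #(slice τ S i a b t) * #(slice τ S i a' b' t) =
      #(slice τ S i a b' t) * #(slice τ S i a' b t) :=
  le_antisymm (card_slice_mul_le hτ S i a b a' b' t) (card_slice_mul_le hτ S i a b' a' b t)

/-- The sets counted omit `i`, so it does not matter on which side of the split `i` lies. This
allows `S` and `insert i S` to be paired when averaging. -/
theorem slice_insert (S : Finset ι) (i : ι) (a b : Finset ι) (t : T) :
    slice τ (insert i S) i a b t = slice τ S i a b t := by
  ext z
  simp only [mem_slice]
  refine and_congr_right fun hz => ?_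
  rw [Finset.inter_insert_of_notMem hz, Finset.sdiff_insert, Finset.erase_eq_of_notMem]
  simp [hz]

/-- The number of sets without `i`. -/
theorem two_mul_card_notMem (i : ι) :
    (2 : ℝ) * #{z : Finset ι | i ∉ z} = 2 ^ Fintype.card ι := by
  have h1 : #{z : Finset ι | i ∉ z} = #{z : Finset ι | i ∈ z} := by
    refine Finset.card_nbij' (fun z => insert i z) (fun z => z.erase i) ?_ ?_ ?_ ?_
    · intro z hz; simp
    · intro z hz; simp
    · intro z hz; simp at hz; simp [hz]
    · intro z hz; simp at hz; simp [hz]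
  have h2 := Finset.card_filter_add_card_filter_not (s := (Finset.univ : Finset (Finset ι)))
    (fun z => i ∈ z)
  rw [← h1, Finset.card_univ, Fintype.card_finset] at h2
  rw [two_mul]
  exact_mod_cast h2

variable [Fintype T]

theorem sum_card_slice (S : Finset ι) (i : ι) (a b : Finset ι) :
    ∑ t, #(slice τ S i a b t) = #{z : Finset ι | i ∉ z} := by
  rw [Finset.card_eq_sum_card_fiberwise (f := fun z => τ (z ∩ S ∪ a) (z \ S ∪ b))
    (t := Finset.univ) (by simp)]
  refine Finset.sum_congr rfl fun t _ => ?_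
  congr 1
  ext z; simp [slice]

/-- The squared Hellinger distance (up to normalization) of the transcripts after changing the
added elements from `(a, b)` to `(a', b')`. -/
noncomputable def hell (τ : Finset ι → Finset ι → T) (S : Finset ι) (i : ι)
    (a b a' b' : Finset ι) : ℝ :=
  ∑ t, (√(#(slice τ S i a b t) : ℝ) - √(#(slice τ S i a' b' t) : ℝ)) ^ 2

theorem hell_insert (S : Finset ι) (i : ι) (a b a' b' : Finset ι) :
    hell τ (insert i S) i a b a' b' = hell τ S i a b a' b' := by
  simp [hell, slice_insert]

/-- The distance depends on the slices only through products of their sizes, which is what cut and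
paste controls. -/
theorem hell_eq (S : Finset ι) (i : ι) (a b a' b' : Finset ι) :
    hell τ S i a b a' b' = 2 * #{z : Finset ι | i ∉ z} -
      2 * ∑ t, √((#(slice τ S i a b t) * #(slice τ S i a' b' t) : ℕ) : ℝ) := by
  have h : ∀ t, (√(#(slice τ S i a b t) : ℝ) - √(#(slice τ S i a' b' t) : ℝ)) ^ 2 =
      #(slice τ S i a b t) + #(slice τ S i a' b' t) -
        2 * √((#(slice τ S i a b t) * #(slice τ S i a' b' t) : ℕ) : ℝ) := by
    intro t
    rw [Nat.cast_mul, Real.sqrt_mul (by positivity), sub_sq, Real.sq_sqrt (by positivity),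
      Real.sq_sqrt (by positivity)]
    ring
  rw [hell, Finset.sum_congr rfl fun t _ => h t, Finset.sum_sub_distrib, Finset.sum_add_distrib,
    ← Finset.mul_sum, ← Nat.cast_sum, ← Nat.cast_sum, sum_card_slice, sum_card_slice]
  ring

/-- By cut and paste, the transcripts for "both have `i`" are close to those for "none has `i`" if
each one-sided change of the input changes the transcripts little. -/
theorem hell_both_le (hτ : ∀ x y x' y', τ x y = τ x' y' → τ x y' = τ x y)
    (S : Finset ι) (i : ι) :
    hell τ S i ∅ ∅ {i} {i} ≤ 2 * (hell τ S i ∅ ∅ {i} ∅ + hell τ S i ∅ ∅ ∅ {i}) := by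
  -- Cut and paste trades "none versus both" for "Bob only versus Alice only"; the route between
  -- these through "none" consists of one-sided changes.
  have h : hell τ S i ∅ ∅ {i} {i} = hell τ S i ∅ {i} {i} ∅ := by
    rw [hell_eq, hell_eq]
    simp_rw [card_slice_mul hτ S i ∅ ∅ {i} {i}]
  rw [h, hell, hell, hell, ← Finset.sum_add_distrib, Finset.mul_sum]
  refine Finset.sum_le_sum fun t _ => ?_
  nlinarith [sq_nonneg ((√(#(slice τ S i ∅ ∅ t) : ℝ) - √(#(slice τ S i {i} ∅ t) : ℝ)) +
    (√(#(slice τ S i ∅ ∅ t) : ℝ) - √(#(slice τ S i ∅ {i} t) : ℝ)))]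

/-- For fixed `S`, toggling `i` in `z` changes only the input of the owner of `i`. Hence the
imbalance of the transcript fibres in coordinate `i` is exactly the Hellinger distance of that
one-sided change. The level-one bound, summed over the fibres, leaves the entropy of the transcript.
-/
theorem hell_split (S : Finset ι) [Nonempty T] :
    ∑ i, (if i ∈ S then hell τ S i ∅ ∅ {i} ∅ else hell τ S i ∅ ∅ ∅ {i}) ≤
      2 * (2 ^ Fintype.card ι * Real.log (Fintype.card T)) := by
  set P : T → Finset (Finset ι) := fun t => {z | τ (z ∩ S) (z \ S) = t} with hP
  have h0 : ∀ i t, #{z ∈ P t | i ∉ z} = #(slice τ S i ∅ ∅ t) := by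
    intro i t
    congr 1
    ext z; simp [hP, slice]; tauto
  have h1 : ∀ i t, #{z ∈ P t | i ∈ z} =
      if i ∈ S then #(slice τ S i {i} ∅ t) else #(slice τ S i ∅ {i} t) := by
    intro i t
    split_ifs with hi
    · have e1 : ∀ z, (z.erase i ∩ S ∪ {i}) = insert i z ∩ S := by
        intro z; ext j; by_cases hj : j = i <;> simp [hj, hi]
      have e2 : ∀ z, (z.erase i) \ S = insert i z \ S := by
        intro z; ext j; by_cases hj : j = i <;> simp [hj, hi]
      refine Finset.card_nbij' (fun z => z.erase i) (fun z => insert i z) ?_ ?_ ?_ ?_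
      · intro z hz
        simp only [hP, Finset.coe_filter, Finset.mem_filter, Set.mem_ofPred_eq, Finset.mem_univ,
          true_and] at hz
        simp only [Finset.mem_coe, mem_slice, Finset.union_empty, e1, e2,
          Finset.insert_eq_of_mem hz.2, hz.1]
        simp
      · intro z hz
        simp only [Finset.mem_coe, mem_slice, Finset.union_empty] at hz
        have := e1 z
        have := e2 z
        simp_all
      · intro z hz; simp at hz; simp [hz]
      · intro z hz; simp [slice] at hz; simp [hz]
    · have e1 : ∀ z, (z.erase i ∩ S) = insert i z ∩ S := by
        intro z; ext j; by_cases hj : j = i <;> simp [hj, hi]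
      have e2 : ∀ z, (z.erase i) \ S ∪ {i} = insert i z \ S := by
        intro z; ext j; by_cases hj : j = i <;> simp [hj, hi]
      refine Finset.card_nbij' (fun z => z.erase i) (fun z => insert i z) ?_ ?_ ?_ ?_
      · intro z hz
        simp only [hP, Finset.coe_filter, Finset.mem_filter, Set.mem_ofPred_eq, Finset.mem_univ,
          true_and] at hz
        simp only [Finset.mem_coe, mem_slice, Finset.union_empty, e1, e2,
          Finset.insert_eq_of_mem hz.2, hz.1]
        simp
      · intro z hz
        simp only [Finset.mem_coe, mem_slice, Finset.union_empty] at hz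
        have := e1 z
        have := e2 z
        simp_all
      · intro z hz; simp at hz; simp [hz]
      · intro z hz; simp [slice] at hz; simp [hz]
  have h2 : ∑ t, (#(P t) : ℝ) = 2 ^ Fintype.card ι := by
    rw [← Nat.cast_sum, ← Finset.card_eq_sum_card_fiberwise (f := fun z => τ (z ∩ S) (z \ S))
      (s := Finset.univ) (by simp)]
    simp
  calc _ = ∑ i, ∑ t, (√(#{z ∈ P t | i ∉ z} : ℝ) - √(#{z ∈ P t | i ∈ z} : ℝ)) ^ 2 := by
        refine Finset.sum_congr rfl fun i _ => ?_
        simp only [h0, h1]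
        split_ifs <;> rfl
    _ = ∑ t, ∑ i, (√(#{z ∈ P t | i ∉ z} : ℝ) - √(#{z ∈ P t | i ∈ z} : ℝ)) ^ 2 :=
        Finset.sum_comm
    _ ≤ ∑ t, 2 * (#(P t) * Real.log (2 ^ Fintype.card ι / #(P t))) :=
        Finset.sum_le_sum fun t _ => sum_sqrt_sub_sqrt_le (P t)
    _ ≤ _ := by
        rw [← Finset.mul_sum]
        gcongr
        exact sum_mul_log_div_le _ (fun t => by positivity) h2 (by positivity)

/-- For random disjoint inputs, adding a common element changes the transcripts little on
average. -/
theorem sum_hell_both_le (hτ : ∀ x y x' y', τ x y = τ x' y' → τ x y' = τ x y) [Nonempty T] :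
    ∑ i, ∑ S with i ∉ S, hell τ S i ∅ ∅ {i} {i} ≤
      4 * 4 ^ Fintype.card ι * Real.log (Fintype.card T) := by
  -- Pairing `S` with `insert i S` collects both one-sided changes of `i` over the same slices.
  have h1 : ∀ i, ∑ S : Finset ι,
      (if i ∈ S then hell τ S i ∅ ∅ {i} ∅ else hell τ S i ∅ ∅ ∅ {i}) =
      ∑ S with i ∉ S, (hell τ S i ∅ ∅ {i} ∅ + hell τ S i ∅ ∅ ∅ {i}) := by
    intro i
    rw [Finset.sum_ite, Finset.sum_add_distrib]
    congr 1
    symm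
    refine Finset.sum_nbij' (fun S => insert i S) (fun S => S.erase i) ?_ ?_ ?_ ?_ ?_
    · intro S hS; simp
    · intro S hS; simp
    · intro S hS; simp at hS; simp [hS]
    · intro S hS; simp at hS; simp [hS]
    · intro S hS; rw [hell_insert]
  calc _ ≤ ∑ i, ∑ S with i ∉ S, 2 * (hell τ S i ∅ ∅ {i} ∅ + hell τ S i ∅ ∅ ∅ {i}) :=
        Finset.sum_le_sum fun i _ => Finset.sum_le_sum fun S _ => hell_both_le hτ S i
    _ = 2 * ∑ S : Finset ι, ∑ i,
          (if i ∈ S then hell τ S i ∅ ∅ {i} ∅ else hell τ S i ∅ ∅ ∅ {i}) := by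
        rw [Finset.sum_comm (s := Finset.univ) (t := Finset.univ)]
        simp_rw [h1, Finset.mul_sum]
    _ ≤ 2 * ∑ S : Finset ι, 2 * (2 ^ Fintype.card ι * Real.log (Fintype.card T)) := by
        gcongr with S _
        exact hell_split S
    _ = _ := by
        rw [Finset.sum_const, Finset.card_univ, Fintype.card_finset, nsmul_eq_mul]
        have : (4 : ℝ) ^ Fintype.card ι = 2 ^ Fintype.card ι * 2 ^ Fintype.card ι := by
          rw [← mul_pow]; norm_num
        push_cast
        rw [this]; ring

/-- Per transcript, `u - v = (√u - √v) * (√u + √v)` is split by the weighted AM-GM inequality. The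
weight `l` stays free, to be balanced against the success probability. -/
theorem sub_card_le (τ : Finset ι → Finset ι → T) (S : Finset ι) (i : ι) (G : T → Prop)
    [DecidablePred G] {l : ℝ} (hl : 0 < l) :
    (#{z : Finset ι | i ∉ z ∧ G (τ (z ∩ S) (z \ S))} : ℝ) -
      #{z : Finset ι | i ∉ z ∧ G (τ (z ∩ S ∪ {i}) (z \ S ∪ {i}))} ≤
      hell τ S i ∅ ∅ {i} {i} / l + l * #{z : Finset ι | i ∉ z} := by
  have h : ∀ a b : Finset ι, #{z : Finset ι | i ∉ z ∧ G (τ (z ∩ S ∪ a) (z \ S ∪ b))} =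
      ∑ t with G t, #(slice τ S i a b t) := by
    intro a b
    rw [Finset.card_eq_sum_card_fiberwise (f := fun z => τ (z ∩ S ∪ a) (z \ S ∪ b))
      (t := Finset.univ.filter G) (by intro z hz; simp at hz; simp [hz])]
    refine Finset.sum_congr rfl fun t ht => ?_
    simp only [Finset.mem_filter, Finset.mem_univ, true_and] at ht
    congr 1
    ext z
    simp only [slice, Finset.mem_filter, Finset.mem_univ, true_and]
    constructor
    · rintro ⟨⟨h1, _⟩, h3⟩; exact ⟨h1, h3⟩
    · rintro ⟨h1, h3⟩; exact ⟨⟨h1, h3 ▸ ht⟩, h3⟩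
  have h00 := h ∅ ∅
  simp only [Finset.union_empty] at h00
  rw [h00, h {i} {i}, Nat.cast_sum, Nat.cast_sum, ← Finset.sum_sub_distrib]
  have key : ∀ u v : ℝ, 0 ≤ u → 0 ≤ v →
      u - v ≤ (√u - √v) ^ 2 / l + l / 2 * (u + v) := by
    intro u v hu hv
    have h1 := Real.sq_sqrt hu
    have h2 := Real.sq_sqrt hv
    rw [← sub_nonneg]
    have : (√u - √v) ^ 2 / l + l / 2 * (u + v) - (u - v) =
        ((√u - √v - l / 2 * (√u + √v)) ^ 2 + (l / 2 * (√u - √v)) ^ 2) / l := by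
      have : l / 2 * (u + v) - (u - v) =
        l / 2 * (√u ^ 2 + √v ^ 2) - (√u ^ 2 - √v ^ 2) := by rw [h1, h2]
      rw [add_sub_assoc, this]
      field_simp
      ring
    rw [this]
    positivity
  calc _ ≤ ∑ t with G t, ((√(#(slice τ S i ∅ ∅ t) : ℝ) - √(#(slice τ S i {i} {i} t) : ℝ)) ^ 2 / l
          + l / 2 * (#(slice τ S i ∅ ∅ t) + #(slice τ S i {i} {i} t))) :=
        Finset.sum_le_sum fun t _ => key _ _ (by positivity) (by positivity)
    _ ≤ ∑ t, ((√(#(slice τ S i ∅ ∅ t) : ℝ) - √(#(slice τ S i {i} {i} t) : ℝ)) ^ 2 / l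
          + l / 2 * (#(slice τ S i ∅ ∅ t) + #(slice τ S i {i} {i} t))) :=
        Finset.sum_le_sum_of_subset_of_nonneg (Finset.filter_subset _ _)
          fun _ _ _ => by positivity
    _ = _ := by
        rw [Finset.sum_add_distrib, ← Finset.sum_div, ← Finset.mul_sum, Finset.sum_add_distrib,
          ← Nat.cast_sum, ← Nat.cast_sum, sum_card_slice, sum_card_slice, hell]
        ring

/-- A partition of the pairs of subsets of `ι` into few rectangles does not tell disjoint pairs
from uniquely intersecting ones. The left side is the total advantage over all `i`, all `S`
without `i` and all `z` without `i` that are split along `S`. -/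
theorem advantage_le (hτ : ∀ x y x' y', τ x y = τ x' y' → τ x y' = τ x y) [Nonempty T]
    (G : T → Prop) [DecidablePred G] {l : ℝ} (hl : 0 < l) :
    ∑ i, ∑ S with i ∉ S, ((#{z : Finset ι | i ∉ z ∧ G (τ (z ∩ S) (z \ S))} : ℝ) -
      #{z : Finset ι | i ∉ z ∧ G (τ (z ∩ S ∪ {i}) (z \ S ∪ {i}))}) ≤
      4 ^ Fintype.card ι * (4 * Real.log (Fintype.card T) / l + l / 4 * Fintype.card ι) := by
  calc _ ≤ ∑ i, ∑ S with i ∉ S, (hell τ S i ∅ ∅ {i} {i} / l + l * #{z : Finset ι | i ∉ z}) :=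
        Finset.sum_le_sum fun i _ => Finset.sum_le_sum fun S _ => sub_card_le τ S i G hl
    _ = (∑ i, ∑ S with i ∉ S, hell τ S i ∅ ∅ {i} {i}) / l +
          ∑ i : ι, l * ((#{z : Finset ι | i ∉ z} : ℝ) * #{z : Finset ι | i ∉ z}) := by
        rw [Finset.sum_div, ← Finset.sum_add_distrib]
        refine Finset.sum_congr rfl fun i _ => ?_
        rw [Finset.sum_add_distrib, Finset.sum_div, Finset.sum_const, nsmul_eq_mul]
        ring
    _ ≤ 4 * 4 ^ Fintype.card ι * Real.log (Fintype.card T) / l +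
          ∑ i : ι, l * ((2 ^ Fintype.card ι / 2) * (2 ^ Fintype.card ι / 2)) := by
        gcongr with i _
        · exact sum_hell_both_le hτ
        · rw [← two_mul_card_notMem i]; simp
        · rw [← two_mul_card_notMem i]; simp
    _ = _ := by
        have : (4 : ℝ) ^ Fintype.card ι = 2 ^ Fintype.card ι * 2 ^ Fintype.card ι := by
          rw [← mul_pow]; norm_num
        rw [Finset.sum_const, Finset.card_univ, nsmul_eq_mul, this]
        ring

end UniqueDisjointness

/-! ### Randomized protocols and the bound for unique disjointness -/

section Reduction

open Finset

/-- Averaging: some outcome of the coins lies in many events of a pair of families if every event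
has a large probability. -/
theorem exists_mem_support_le_card {Ω J : Type} (P : PMF Ω) (s : Finset J) (E F : J → Set Ω)
    {p : ℝ} (hp : 0 ≤ p) (hE : ∀ j ∈ s, ENNReal.ofReal p ≤ P.toOuterMeasure (E j))
    (hF : ∀ j ∈ s, ENNReal.ofReal p ≤ P.toOuterMeasure (F j)) [∀ ω j, Decidable (ω ∈ E j)]
    [∀ ω j, Decidable (ω ∈ F j)] :
    ∃ ω ∈ P.support, 2 * p * #s ≤ (#{j ∈ s | ω ∈ E j} : ℝ) + #{j ∈ s | ω ∈ F j} := by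
  by_contra! h
  have key : ∀ (A : J → Set Ω) [∀ ω j, Decidable (ω ∈ A j)],
      ∑ j ∈ s, P.toOuterMeasure (A j) = ∑' ω, P ω * (#{j ∈ s | ω ∈ A j} : ℝ≥0∞) := by
    intro A _
    simp_rw [PMF.toOuterMeasure_apply]
    rw [← Summable.tsum_finsetSum (fun _ _ => ENNReal.summable)]
    refine tsum_congr fun ω => ?_
    simp_rw [Set.indicator_apply]
    rw [← Finset.sum_filter, Finset.sum_const, nsmul_eq_mul, mul_comm]
  -- The counts are integers, so the strict bounds improve to a single bound `m < 2 * p * #s`, and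
  -- strictness survives the infinite sum over the coins.
  set m := ⌈2 * p * #s⌉₊ - 1 with hm
  have hlt : ∀ ω ∈ P.support, #{j ∈ s | ω ∈ E j} + #{j ∈ s | ω ∈ F j} ≤ m := by
    intro ω hω
    have := h ω hω
    have : #{j ∈ s | ω ∈ E j} + #{j ∈ s | ω ∈ F j} < ⌈2 * p * #s⌉₊ := by
      rw [Nat.lt_ceil]; push_cast; exact this
    omega
  have hpos : 0 < 2 * p * #s := by
    obtain ⟨ω, hω⟩ := P.support_nonempty
    exact lt_of_le_of_lt (by positivity) (h ω hω)
  have hm' : (m : ℝ) < 2 * p * #s := by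
    rw [← Nat.lt_ceil]
    have := Nat.ceil_pos.2 hpos
    omega
  have h1 : ENNReal.ofReal (2 * p * #s) ≤
      ∑ j ∈ s, P.toOuterMeasure (E j) + ∑ j ∈ s, P.toOuterMeasure (F j) := by
    calc _ = ∑ j ∈ s, ENNReal.ofReal p + ∑ j ∈ s, ENNReal.ofReal p := by
          rw [Finset.sum_const, nsmul_eq_mul, ← two_mul, ENNReal.ofReal_mul (by positivity),
            ENNReal.ofReal_mul (by positivity)]
          simp; ring
      _ ≤ _ := add_le_add (Finset.sum_le_sum hE) (Finset.sum_le_sum hF)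
  have h2 : ∑ j ∈ s, P.toOuterMeasure (E j) + ∑ j ∈ s, P.toOuterMeasure (F j) ≤ m := by
    rw [key, key, ← ENNReal.tsum_add]
    calc _ ≤ ∑' ω, P ω * (m : ℝ≥0∞) := by
          refine ENNReal.tsum_le_tsum fun ω => ?_
          rw [← mul_add]
          by_cases hω : ω ∈ P.support
          · gcongr
            exact_mod_cast hlt ω hω
          · rw [PMF.mem_support_iff, not_not] at hω
            simp [hω]
      _ = m := by rw [ENNReal.tsum_mul_right, P.tsum_coe, one_mul]
  have h3 := h1.trans h2
  rw [← ENNReal.ofReal_natCast, ENNReal.ofReal_le_ofReal_iff (by positivity)] at h3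
  linarith

variable {ι : Type} [Fintype ι] [DecidableEq ι] {X Y Z : Type}

-- The transcripts serve as the parts: there are at most `2 ^ C` codes, and acceptance depends only
-- on the code because the output does.
open Classical in
theorem Protocol.advantage_le (π : Protocol X Y Z) (f : Finset ι → X) (g : Finset ι → Y)
    (acc : Z → Prop) {C : ℕ} (hC : ∀ x y, π.bits x y ≤ C) {l : ℝ} (hl : 0 < l) :
    ∑ i, ∑ S with i ∉ S,
      ((#{z : Finset ι | i ∉ z ∧ acc (π.run (f (z ∩ S)) (g (z \ S)))} : ℝ) -
        #{z : Finset ι | i ∉ z ∧ acc (π.run (f (z ∩ S ∪ {i})) (g (z \ S ∪ {i})))}) ≤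
      4 ^ Fintype.card ι * (4 * C / l + l / 4 * Fintype.card ι) := by
  let τ : Finset ι → Finset ι → Fin (2 ^ C) := fun x y =>
    ⟨π.code (f x) (g y), (π.code_lt _ _).trans_le (Nat.pow_le_pow_right two_pos (hC _ _))⟩
  have hτ : ∀ x y x' y', τ x y = τ x' y' → τ x y' = τ x y := by
    intro x y x' y' h
    simp only [τ, Fin.mk.injEq] at h ⊢
    exact π.code_cross h
  let G : Fin (2 ^ C) → Prop := fun t => ∃ x y, τ x y = t ∧ acc (π.run (f x) (g y))
  have hG : ∀ x y, G (τ x y) ↔ acc (π.run (f x) (g y)) := by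
    intro x y
    constructor
    · rintro ⟨x', y', h, h'⟩
      simp only [τ, Fin.mk.injEq] at h
      rwa [π.run_eq_of_code_eq h] at h'
    · exact fun h => ⟨x, y, rfl, h⟩
  have : Nonempty (Fin (2 ^ C)) := ⟨⟨0, by positivity⟩⟩
  have h := StableMarriage.advantage_le hτ G hl
  simp only [hG] at h
  refine h.trans ?_
  gcongr
  rw [Fintype.card_fin]
  push_cast
  rw [Real.log_pow]
  have := Real.log_two_lt_d9
  have hC0 : (0 : ℝ) ≤ C := by positivity
  nlinarith

/-- The number of triples that index the advantage. -/
theorem sum_sum_card_notMem :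
    ∑ i : ι, ∑ S : Finset ι with i ∉ S, (#{z : Finset ι | i ∉ z} : ℝ) =
      4 ^ Fintype.card ι / 4 * Fintype.card ι := by
  have : ∀ i : ι, ∑ S : Finset ι with i ∉ S, (#{z : Finset ι | i ∉ z} : ℝ) =
      4 ^ Fintype.card ι / 4 := by
    intro i
    have h := two_mul_card_notMem i
    have e : (4 : ℝ) ^ Fintype.card ι = 2 ^ Fintype.card ι * 2 ^ Fintype.card ι := by
      rw [← mul_pow]; norm_num
    rw [Finset.sum_const, nsmul_eq_mul, e, ← h]
    ring
  rw [Finset.sum_congr rfl fun i _ => this i, Finset.sum_const, Finset.card_univ, nsmul_eq_mul]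
  ring

/-- A search problem that embeds unique disjointness on `ι` has communication complexity linear in
the size of `ι`. -/
theorem le_cost {P : RandProtocol X Y Z} {p : ℝ} (hp : 1 / 2 < p)
    {R : X → Y → Z → Prop} (hP : P.Solves p R) (f : Finset ι → X) (g : Finset ι → Y)
    (acc : Z → Prop)
    (h0 : ∀ x y, Disjoint x y → (∃ z, R (f x) (g y) z) ∧ ∀ z, R (f x) (g y) z → acc z)
    (h1 : ∀ x y i, x ∩ y = {i} → (∃ z, R (f x) (g y) z) ∧ ∀ z, R (f x) (g y) z → ¬ acc z) :
    ENNReal.ofReal ((2 * p - 1) ^ 2 / 64 * Fintype.card ι) ≤ ((P.cost : ℕ∞) : ℝ≥0∞) := by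
  classical
  rcases eq_or_ne P.cost ⊤ with h | h
  · simp [h]
  obtain ⟨C, hC⟩ := ENat.ne_top_iff_exists.1 h
  have hbits : ∀ π ∈ P.support, ∀ x y, π.bits x y ≤ C := by
    intro π hπ x y
    have : (π.bits x y : ℕ∞) ≤ P.cost :=
      (le_iSup₂ (f := fun x y => (π.bits x y : ℕ∞)) x y).trans
        (le_iSup₂ (f := fun (π : Protocol X Y Z) (_ : π ∈ P.support) =>
          ⨆ x : X, ⨆ y : Y, (π.bits x y : ℕ∞)) π hπ)
    rw [← hC] at this
    exact_mod_cast this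
  rw [← hC, ENat.toENNReal_coe, ← ENNReal.ofReal_natCast]
  refine ENNReal.ofReal_le_ofReal ?_
  set J : Finset (ι × Finset ι × Finset ι) := {j | j.1 ∉ j.2.1 ∧ j.1 ∉ j.2.2} with hJ
  have hcard : ∀ (Q : ι → Finset ι → Finset ι → Prop) [∀ i S z, Decidable (Q i S z)],
      (#{j ∈ J | Q j.1 j.2.1 j.2.2} : ℝ) =
        ∑ i, ∑ S with i ∉ S, (#{z : Finset ι | i ∉ z ∧ Q i S z} : ℝ) := by
    intro Q _
    rw [hJ, Finset.filter_filter, Finset.card_filter, Nat.cast_sum, Fintype.sum_prod_type]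
    refine Finset.sum_congr rfl fun i _ => ?_
    rw [Fintype.sum_prod_type, Finset.sum_filter]
    refine Finset.sum_congr rfl fun S _ => ?_
    split_ifs with hS
    · refine Finset.sum_eq_zero fun z _ => ?_
      simp [hS]
    · rw [Finset.card_filter, Nat.cast_sum]
      refine Finset.sum_congr rfl fun z _ => ?_
      simp [hS]
  obtain ⟨π, hπ, hle⟩ := exists_mem_support_le_card P J
    (fun j => {π | acc (π.run (f (j.2.2 ∩ j.2.1)) (g (j.2.2 \ j.2.1)))})
    (fun j => {π | ¬ acc (π.run (f (j.2.2 ∩ j.2.1 ∪ {j.1})) (g (j.2.2 \ j.2.1 ∪ {j.1})))})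
    (p := p) (by linarith)
    (fun j _ => by
      obtain ⟨ha, hb⟩ := h0 (j.2.2 ∩ j.2.1) (j.2.2 \ j.2.1)
        (Finset.disjoint_left.2 fun a => by simp; tauto)
      exact (hP _ _ ha).trans (P.toOuterMeasure.mono fun π hπ => hb _ hπ))
    (fun j hj => by
      simp only [hJ, Finset.mem_filter, Finset.mem_univ, true_and] at hj
      obtain ⟨ha, hb⟩ := h1 (j.2.2 ∩ j.2.1 ∪ {j.1}) (j.2.2 \ j.2.1 ∪ {j.1}) j.1
        (by
          ext a
          by_cases hja : a = j.1
          · simp [hja]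
          · simp [hja]; tauto)
      exact (hP _ _ ha).trans (P.toOuterMeasure.mono fun π hπ => hb _ hπ))
  have hadv : ∀ l : ℝ, 0 < l → _ := fun l hl => π.advantage_le f g acc (hbits π hπ) hl
  simp only [Set.mem_ofPred_eq] at hle
  have hnot := Finset.card_filter_add_card_filter_not (s := J)
    (fun j => acc (π.run (f (j.2.2 ∩ j.2.1 ∪ {j.1})) (g (j.2.2 \ j.2.1 ∪ {j.1}))))
  have hnot' : (#{j ∈ J | acc (π.run (f (j.2.2 ∩ j.2.1 ∪ {j.1})) (g (j.2.2 \ j.2.1 ∪ {j.1})))} : ℝ)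
      + #{j ∈ J | ¬ acc (π.run (f (j.2.2 ∩ j.2.1 ∪ {j.1})) (g (j.2.2 \ j.2.1 ∪ {j.1})))} = #J := by
    exact_mod_cast hnot
  have hJcard : (#J : ℝ) = 4 ^ Fintype.card ι / 4 * Fintype.card ι := by
    have := hcard (fun _ _ _ => True)
    simp only [Finset.filter_true, and_true] at this
    rw [this, sum_sum_card_notMem]
  have hE := hcard (fun i S z => acc (π.run (f (z ∩ S)) (g (z \ S))))
  have hF := hcard (fun i S z => acc (π.run (f (z ∩ S ∪ {i})) (g (z \ S ∪ {i}))))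
  simp only [Finset.sum_sub_distrib] at hadv
  rw [← hE, ← hF] at hadv
  -- The advantage is at least `(2 * p - 1) / 4 * |ι|`, up to the factor `4 ^ |ι|`. This weight
  -- makes the error term half of it; the other half bounds `C` and produces the constant `1 / 64`.
  have hfin := hadv ((2 * p - 1) / 2) (by linarith)
  have h4 : (0 : ℝ) < 4 ^ Fintype.card ι := by positivity
  have hγ : 0 < 2 * p - 1 := by linarith
  have hmain : 4 ^ Fintype.card ι * ((2 * p - 1) / 4 * Fintype.card ι) ≤
      4 ^ Fintype.card ι *
        (4 * C / ((2 * p - 1) / 2) + (2 * p - 1) / 2 / 4 * Fintype.card ι) := by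
    rw [hJcard] at hle hnot'
    linarith
  have hmain' := le_of_mul_le_mul_left hmain h4
  have h8 : (2 * p - 1) / 8 * Fintype.card ι ≤ 8 * C / (2 * p - 1) := by
    have : 4 * (C : ℝ) / ((2 * p - 1) / 2) = 8 * C / (2 * p - 1) := by
      field_simp; ring
    linarith
  rw [le_div_iff₀ hγ] at h8
  linarith

end Reduction

/-! ### The market that embeds unique disjointness -/

section Gadget

variable {k l : ℕ}

/-- Each side of the market: `k` agents whose lists encode the input, `k` default partners of such
agents of the other side, and a chain of `l + 1` agents. Of the women, the first `k` encode Alice's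
input; of the men, the second `k` encode Bob's input. -/
abbrev Agent (k l : ℕ) : Type := Fin k ⊕ Fin k ⊕ Fin (l + 1)

/-- The class of a man on the list of a woman (lower is better). -/
def classW (x : Finset (Fin k × Fin k)) : Agent k l → Agent k l → ℕ
  | .inl i, .inl i' => if i' = i then 1 else 2
  | .inl i, .inr (.inl j) => if (i, j) ∈ x then 0 else 2
  | .inl _, .inr (.inr _) => 2
  | .inr (.inl _), .inl _ => 2
  | .inr (.inl j), .inr (.inl j') => if j' = j then 0 else 2
  | .inr (.inl _), .inr (.inr t) => if t = Fin.last l then 1 else 2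
  | .inr (.inr t), .inl _ => if t = 0 then 0 else 2
  | .inr (.inr _), .inr (.inl _) => 2
  | .inr (.inr t), .inr (.inr s) => if s = t then 1 else if s.val + 1 = t.val then 0 else 2

/-- The class of a woman on the list of a man (lower is better). -/
def classM (y : Finset (Fin k × Fin k)) : Agent k l → Agent k l → ℕ
  | .inl i, .inl i' => if i' = i then 0 else 2
  | .inl _, .inr (.inl _) => 2
  | .inl _, .inr (.inr t) => if t = 0 then 1 else 2
  | .inr (.inl j), .inl i => if (i, j) ∈ y then 0 else 2
  | .inr (.inl j), .inr (.inl j') => if j' = j then 1 else 2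
  | .inr (.inl _), .inr (.inr _) => 2
  | .inr (.inr _), .inl _ => 2
  | .inr (.inr t), .inr (.inl _) => if t = Fin.last l then 1 else 2
  | .inr (.inr t), .inr (.inr s) => if s = t then 0 else if t.val + 1 = s.val then 1 else 2

/-- No woman and man are in strictly better classes for each other than their spouses. -/
def ClassStable (x y : Finset (Fin k × Fin k)) (σ : Agent k l ≃ Agent k l) : Prop :=
  ∀ w m, classW x w m < classW x w (σ w) → ¬ classM y m w < classM y m (σ.symm m)

/-- Every woman and man who are in weakly better classes for each other than their spouses are
married to each other. -/
def StrictlyClassStable (x y : Finset (Fin k × Fin k)) (σ : Agent k l ≃ Agent k l) : Prop :=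
  ∀ w m, classW x w m ≤ classW x w (σ w) → classM y m w ≤ classM y m (σ.symm m) → σ w = m

/-- The marriage in which the input-encoding agents `i` and `j` are married. Their default partners
and the chain move up. -/
def shift (i j : Fin k) : Agent k l ≃ Agent k l where
  toFun
    | .inl i' => if i' = i then .inr (.inl j) else .inl i'
    | .inr (.inl j') => if j' = j then .inr (.inr (Fin.last l)) else .inr (.inl j')
    | .inr (.inr t) => Fin.cases (.inl i) (fun s => .inr (.inr s.castSucc)) t
  invFun
    | .inl i' => if i' = i then .inr (.inr 0) else .inl i'
    | .inr (.inl j') => if j' = j then .inl i else .inr (.inl j')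
    | .inr (.inr t) => Fin.lastCases (.inr (.inl j)) (fun s => .inr (.inr s.succ)) t
  left_inv := by
    rintro (i' | j' | t)
    · by_cases h : i' = i <;> simp [h]
    · by_cases h : j' = j <;> simp [h]
    · refine Fin.cases ?_ (fun s => ?_) t <;> simp
  right_inv := by
    rintro (i' | j' | t)
    · by_cases h : i' = i <;> simp [h]
    · by_cases h : j' = j <;> simp [h]
    · refine Fin.lastCases ?_ (fun s => ?_) t <;> simp

section Shift

variable (i j : Fin k)

theorem shift_left_self : shift i j (.inl i : Agent k l) = .inr (.inl j) := by simp [shift]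

theorem shift_mid_self : shift i j (.inr (.inl j) : Agent k l) = .inr (.inr (Fin.last l)) := by
  simp [shift]

theorem shift_right_zero : shift i j (.inr (.inr 0) : Agent k l) = .inl i := by simp [shift]

theorem shift_right_succ (t : Fin l) :
    shift i j (.inr (.inr t.succ) : Agent k l) = .inr (.inr t.castSucc) := by
  simp [shift]

variable {i j}

theorem shift_left_of_ne {i' : Fin k} (h : i' ≠ i) :
    shift i j (.inl i' : Agent k l) = .inl i' := by simp [shift, h]

theorem shift_mid_of_ne {j' : Fin k} (h : j' ≠ j) :
    shift i j (.inr (.inl j') : Agent k l) = .inr (.inl j') := by simp [shift, h]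

end Shift

/-! ### Stability of the default and the shifted marriage -/

variable {x y : Finset (Fin k × Fin k)}

/-- Default men of encoding women and chain men have the only woman of their top class. An encoding
man `j` could gain only from a woman `i` with `(i, j) ∈ y`, who is interested only if `(i, j) ∈ x`.
-/
theorem strictlyClassStable_refl (h : Disjoint x y) :
    StrictlyClassStable x y (Equiv.refl (Agent k l)) := by
  rw [Finset.disjoint_left] at h
  rintro (i | j | t) (i' | j' | s) h1 h2 <;>
    simp only [classW, classM, Equiv.refl_apply, Equiv.refl_symm] at h1 h2 ⊢ <;> grind

theorem mem_and_mem_iff {i j i' j' : Fin k} (h : x ∩ y = {(i, j)}) :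
    ((i', j') ∈ x ∧ (i', j') ∈ y) ↔ i' = i ∧ j' = j := by
  rw [← Finset.mem_inter, h]; simp

/-- Ties in class `0` are harmless: the first chain woman ranks all men `.inl i'` on top, but those
with `i' ≠ i` keep the only woman of their own top class. The other grid points are not common to
`x` and `y`. -/
theorem strictlyClassStable_shift {i j : Fin k} (h : x ∩ y = {(i, j)}) :
    StrictlyClassStable x y (shift i j : Agent k l ≃ Agent k l) := by
  have h' := fun i' j' => mem_and_mem_iff (i' := i') (j' := j') h
  have hij := (h' i j).2 ⟨rfl, rfl⟩
  rintro (i' | j' | t) m h1 h2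
  · by_cases hi : i' = i
    · subst hi
      rw [shift_left_self] at h1 ⊢
      rcases m with i'' | j'' | s <;>
        simp only [shift, Equiv.coe_fn_symm_mk, classW, classM] at h1 h2 ⊢ <;>
        grind [classM, classW]
    · rw [shift_left_of_ne hi] at h1 ⊢
      rcases m with i'' | j'' | s <;>
        simp only [shift, Equiv.coe_fn_symm_mk, classW, classM] at h1 h2 ⊢ <;>
        grind [classM, classW]
  · by_cases hj : j' = j
    · subst hj
      rw [shift_mid_self] at h1 ⊢
      rcases m with i'' | j'' | s <;>
        simp only [shift, Equiv.coe_fn_symm_mk, classW, classM] at h1 h2 ⊢ <;>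
        grind [classM, classW]
    · rw [shift_mid_of_ne hj] at h1 ⊢
      rcases m with i'' | j'' | s <;>
        simp only [shift, Equiv.coe_fn_symm_mk, classW, classM] at h1 h2 ⊢ <;>
        grind [classM, classW]
  · induction t using Fin.cases with
    | zero =>
      rw [shift_right_zero] at h1 ⊢
      rcases m with i'' | j'' | s <;>
        simp only [shift, Equiv.coe_fn_symm_mk, classW, classM] at h1 h2 ⊢ <;>
        grind [classM, classW]
    | succ t =>
      rw [shift_right_succ] at h1 ⊢
      rcases m with i'' | j'' | s <;>
        simp only [classW, Fin.val_castSucc, Fin.val_succ] at h1 h2 ⊢ <;>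
        grind

theorem classW_left_le_one {i : Fin k} {m : Agent k l} : classW x (.inl i) m ≤ 1 ↔
    m = .inl i ∨ ∃ j, m = .inr (.inl j) ∧ (i, j) ∈ x := by
  rcases m with i' | j | t <;> simp only [classW] <;> grind

theorem classW_mid_le_zero {j : Fin k} {m : Agent k l} : classW x (.inr (.inl j)) m ≤ 0 ↔
    m = .inr (.inl j) := by
  rcases m with i' | j | t <;> simp only [classW] <;> grind

theorem classW_right_le_zero {t : Fin (l + 1)} {m : Agent k l} :
    classW x (.inr (.inr t)) m ≤ 0 ↔
      (t = 0 ∧ ∃ i, m = .inl i) ∨ ∃ s, m = .inr (.inr s) ∧ s.val + 1 = t.val := by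
  rcases m with i' | j | t <;> simp only [classW] <;> grind

theorem classW_right_le_one {t : Fin (l + 1)} {m : Agent k l} :
    classW x (.inr (.inr t)) m ≤ 1 ↔
      m = .inr (.inr t) ∨ classW x (.inr (.inr t)) m ≤ 0 := by
  rcases m with i' | j | t <;> simp only [classW] <;> grind

theorem classM_left_le_zero {i : Fin k} {w : Agent k l} : classM y (.inl i) w ≤ 0 ↔
    w = .inl i := by
  rcases w with i' | j | t <;> simp only [classM] <;> grind

theorem classM_left_le_one {i : Fin k} {w : Agent k l} : classM y (.inl i) w ≤ 1 ↔
    w = .inl i ∨ w = .inr (.inr 0) := by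
  rcases w with i' | j | t <;> simp only [classM] <;> grind

theorem classM_mid_le_one {j : Fin k} {w : Agent k l} : classM y (.inr (.inl j)) w ≤ 1 ↔
    w = .inr (.inl j) ∨ ∃ i, w = .inl i ∧ (i, j) ∈ y := by
  rcases w with i' | j | t <;> simp only [classM] <;> grind

theorem classM_right_le_zero {t : Fin (l + 1)} {w : Agent k l} :
    classM y (.inr (.inr t)) w ≤ 0 ↔ w = .inr (.inr t) := by
  rcases w with i' | j | t <;> simp only [classM] <;> grind

theorem classM_castSucc_le_one {t : Fin l} {w : Agent k l} :
    classM y (.inr (.inr t.castSucc)) w ≤ 1 ↔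
      w = .inr (.inr t.castSucc) ∨ w = .inr (.inr t.succ) := by
  rcases w with i' | j | t <;> simp only [classM] <;> grind

/-! ### Uniqueness of the stable marriage -/

variable {σ : Agent k l ≃ Agent k l}

theorem ClassStable.le_or_le (h : ClassStable x y σ) (w m : Agent k l) :
    classW x w (σ w) ≤ classW x w m ∨ classM y m (σ.symm m) ≤ classM y m w := by
  by_contra! hc
  exact h w m hc.1 hc.2

/-- She alone is in the top class of her default man, so she never has to settle for less than him.
`ClassStable.mid` is the same for encoding men, with the roles of the sexes exchanged. -/
theorem ClassStable.left (h : ClassStable x y σ) (i : Fin k) :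
    σ (.inl i) = .inl i ∨ ∃ j, σ (.inl i) = .inr (.inl j) ∧ (i, j) ∈ x := by
  rcases h.le_or_le (.inl i) (.inl i) with h | h
  · exact classW_left_le_one.1 (h.trans (by simp [classW]))
  · left
    have := classM_left_le_zero.1 (h.trans (by simp [classM]))
    rwa [Equiv.symm_apply_eq, eq_comm] at this

theorem ClassStable.mid (h : ClassStable x y σ) (j : Fin k) :
    σ (.inr (.inl j)) = .inr (.inl j) ∨ ∃ i, σ (.inl i) = .inr (.inl j) ∧ (i, j) ∈ y := by
  rcases h.le_or_le (.inr (.inl j)) (.inr (.inl j)) with h | h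
  · left
    exact classW_mid_le_zero.1 (h.trans (by simp [classW]))
  · have := classM_mid_le_one.1 (h.trans (by simp [classM]))
    simp only [Equiv.symm_apply_eq] at this
    rcases this with h | ⟨i, h, hi⟩
    · exact Or.inl h.symm
    · exact Or.inr ⟨i, h.symm, hi⟩

/-- Pairs of input-encoding agents can only be married at common elements of the inputs. -/
theorem ClassStable.mem_of_apply (h : ClassStable x y σ) {i j : Fin k}
    (hij : σ (.inl i) = .inr (.inl j)) : (i, j) ∈ x ∧ (i, j) ∈ y := by
  constructor
  · rcases h.left i with h | ⟨j', h, hj⟩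
    · simp [h] at hij
    · rw [h] at hij
      simp only [Sum.inr.injEq, Sum.inl.injEq] at hij
      rwa [← hij]
  · rcases h.mid j with h | ⟨i', h, hi⟩
    · have := σ.injective (hij.trans h.symm)
      simp at this
    · have := σ.injective (hij.trans h.symm)
      simp only [Sum.inl.injEq] at this
      rwa [this]

theorem ClassStable.left_eq (h : ClassStable x y σ) {i : Fin k}
    (hi : ∀ j, ¬ ((i, j) ∈ x ∧ (i, j) ∈ y)) : σ (.inl i) = .inl i := by
  rcases h.left i with h' | ⟨j, h', _⟩
  · exact h'
  · exact absurd (h.mem_of_apply h') (hi j)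

theorem ClassStable.mid_eq (h : ClassStable x y σ) {j : Fin k}
    (hj : ∀ i, ¬ ((i, j) ∈ x ∧ (i, j) ∈ y)) : σ (.inr (.inl j)) = .inr (.inl j) := by
  rcases h.mid j with h' | ⟨i, h', _⟩
  · exact h'
  · exact absurd (h.mem_of_apply h') (hj i)

/-- If the inputs are disjoint, then only the default marriage can be stable. -/
theorem ClassStable.eq_refl (h : ClassStable x y σ) (hxy : Disjoint x y) :
    σ = Equiv.refl _ := by
  have hno : ∀ i j, ¬ ((i, j) ∈ x ∧ (i, j) ∈ y) :=
    fun i j hij => Finset.disjoint_left.1 hxy hij.1 hij.2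
  have hl : ∀ i, σ (.inl i) = .inl i := fun i => h.left_eq (hno i)
  -- Each chain woman can always get her default man. The men she likes better are taken: by
  -- encoding women at the start of the chain, later by the preceding chain woman.
  have hr : ∀ t, σ (.inr (.inr t)) = .inr (.inr t) := by
    have key : ∀ t, ¬ classW x (.inr (.inr t)) (σ (.inr (.inr t))) ≤ 0 →
        σ (.inr (.inr t)) = .inr (.inr t) := by
      intro t h0
      rcases h.le_or_le (.inr (.inr t)) (.inr (.inr t)) with h' | h'
      · exact (classW_right_le_one.1 (h'.trans (by simp [classW]))).resolve_right h0
      · have := classM_right_le_zero.1 (h'.trans (by simp [classM]))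
        rwa [Equiv.symm_apply_eq, eq_comm] at this
    intro t
    induction t using Fin.induction with
    | zero =>
      refine key _ fun h0 => ?_
      rcases classW_right_le_zero.1 h0 with ⟨_, i, hi⟩ | ⟨s, _, hs⟩
      · have := σ.injective (hi.trans (hl i).symm)
        simp at this
      · simp at hs
    | succ t ih =>
      refine key _ fun h0 => ?_
      rcases classW_right_le_zero.1 h0 with ⟨h1, _⟩ | ⟨s, hs, hst⟩
      · simp at h1
      · have e : s = t.castSucc := by
          simp only [Fin.val_succ, Nat.add_right_cancel_iff] at hst
          exact Fin.ext hst
        rw [e, ← ih] at hs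
        have := σ.injective hs
        simp [Fin.ext_iff] at this
  ext w : 1
  rcases w with i | j | t
  · exact hl i
  · exact h.mid_eq fun i => hno i j
  · exact hr t

/-- If the inputs have exactly one common element, then only the corresponding shifted marriage can
be stable. -/
theorem ClassStable.eq_shift (h : ClassStable x y σ) {i j : Fin k} (hxy : x ∩ y = {(i, j)}) :
    σ = shift i j := by
  have hmem := fun i' j' => mem_and_mem_iff (i' := i') (j' := j') hxy
  have hl : ∀ i', i' ≠ i → σ (.inl i') = .inl i' := fun i' hi =>
    h.left_eq fun j' hj => hi ((hmem i' j').1 hj).1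
  have hm : ∀ j', j' ≠ j → σ (.inr (.inl j')) = .inr (.inl j') := fun j' hj =>
    h.mid_eq fun i' hi => hj ((hmem i' j').1 hi).2
  -- Otherwise both would be with their default partners and would block.
  have hij : σ (.inl i) = .inr (.inl j) := by
    obtain ⟨hx, hy⟩ := (hmem i j).2 ⟨rfl, rfl⟩
    rcases h.left i with h1 | ⟨j', h1, _⟩
    · rcases h.mid j with h2 | ⟨i', h2, hi'⟩
      · rcases h.le_or_le (.inl i) (.inr (.inl j)) with h' | h'
        · rw [h1] at h'
          simp [classW, hx] at h'
        · rw [(Equiv.symm_apply_eq σ).2 h2.symm] at h'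
          simp [classM, hy] at h'
      · rwa [((hmem _ _).1 (h.mem_of_apply h2)).1] at h2
    · rwa [((hmem _ _).1 (h.mem_of_apply h1)).2] at h1
  have h0 : σ (.inr (.inr 0)) = .inl i := by
    rcases h.le_or_le (.inr (.inr 0)) (.inl i) with h' | h'
    · rcases classW_right_le_zero.1 (h'.trans (by simp [classW])) with ⟨_, i', hi⟩ | ⟨s, _, hs⟩
      · by_cases e : i' = i
        · rwa [e] at hi
        · have := σ.injective (hi.trans (hl i' e).symm)
          simp at this
      · simp at hs
    · rcases classM_left_le_one.1 (h'.trans (by simp [classM])) with h1 | h1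
      · rw [Equiv.symm_apply_eq, hij] at h1
        simp at h1
      · exact ((Equiv.symm_apply_eq σ).1 h1).symm
  -- A chain man who has lost his default woman goes to the next one, who prefers him to her own
  -- default man. This carries the displacement along the chain.
  have key : ∀ t : Fin l, σ (.inr (.inr t.castSucc)) ≠ .inr (.inr t.castSucc) →
      σ (.inr (.inr t.succ)) = .inr (.inr t.castSucc) := by
    intro t hne
    rcases h.le_or_le (.inr (.inr t.succ)) (.inr (.inr t.castSucc)) with h' | h'
    · have hc : classW x (.inr (.inr t.succ)) (.inr (.inr t.castSucc) : Agent k l) = 0 := by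
        simp [classW, Fin.ext_iff]
      rcases classW_right_le_zero.1 (h'.trans hc.le) with ⟨h1, _⟩ | ⟨s, hs, hst⟩
      · simp at h1
      · simp only [Fin.val_succ, Nat.add_right_cancel_iff] at hst
        rw [hs, Fin.ext (a := s) (b := t.castSucc) hst]
    · have hc : classM y (.inr (.inr t.castSucc)) (.inr (.inr t.succ) : Agent k l) ≤ 1 := by
        simp [classM, Fin.ext_iff]
      rcases classM_castSucc_le_one.1 (h'.trans hc) with h1 | h1
      · exact absurd ((Equiv.symm_apply_eq σ).1 h1).symm hne
      · exact ((Equiv.symm_apply_eq σ).1 h1).symm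
  have hne : ∀ t : Fin (l + 1), σ (.inr (.inr t)) ≠ .inr (.inr t) := by
    intro t
    induction t using Fin.induction with
    | zero => simp [h0]
    | succ t ih => simp [key t ih, Fin.ext_iff]
  have hs : ∀ t : Fin l, σ (.inr (.inr t.succ)) = .inr (.inr t.castSucc) :=
    fun t => key t (hne _)
  -- By elimination: every other man already has a wife.
  have hlast : σ (.inr (.inl j)) = .inr (.inr (Fin.last l)) := by
    rcases e : σ (.inr (.inl j)) with i' | j' | t
    · by_cases hi : i' = i
      · exact absurd (σ.injective (e.trans ((congrArg _ hi).trans h0.symm))) (by simp)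
      · exact absurd (σ.injective (e.trans (hl i' hi).symm)) (by simp)
    · by_cases hj : j' = j
      · exact absurd (σ.injective (e.trans ((congrArg (Sum.inr ∘ Sum.inl) hj).trans hij.symm)))
          (by simp)
      · exact absurd (σ.injective (e.trans (hm j' hj).symm)) (by simp [Ne.symm hj])
    · induction t using Fin.lastCases with
      | last => rfl
      | cast t =>
        exact absurd (σ.injective (e.trans (hs t).symm)) (by simp)
  ext w : 1
  rcases w with i' | j' | t
  · by_cases hi : i' = i
    · rw [hi, hij, shift_left_self]
    · rw [hl i' hi, shift_left_of_ne hi]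
  · by_cases hj : j' = j
    · rw [hj, hlast, shift_mid_self]
    · rw [hm j' hj, shift_mid_of_ne hj]
  · induction t using Fin.cases with
    | zero => rw [h0, shift_right_zero]
    | succ t => rw [hs, shift_right_succ]

theorem shift_right_ne (i j : Fin k) (t : Fin (l + 1)) :
    shift i j (.inr (.inr t) : Agent k l) ≠ .inr (.inr t) := by
  induction t using Fin.cases with
  | zero => simp [shift_right_zero]
  | succ t => simp [shift_right_succ, Fin.ext_iff]

end Gadget

/-! ### From classes to full preference lists, and the final bound -/

/-- The list that is sorted by an injective key. -/
def PrefList.ofKey {A B : Type} [LinearOrder B] (r : A → B) (hr : Function.Injective r) :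
    PrefList A where
  prefers a b := r a < r b
  isStrictTotalOrder :=
    { irrefl := fun _ => lt_irrefl _
      trans := fun _ _ _ => lt_trans
      trichotomous := fun _ _ h1 h2 => hr (le_antisymm (not_lt.1 h2) (not_lt.1 h1)) }

section Market

open Finset

variable {k l n : ℕ} (e : Fin n ≃ Agent k l)

/-- The women's lists: sorted by class, ties broken by index. -/
def womenProfile (x : Finset (Fin k × Fin k)) : Profile (Fin n) (Fin n) := fun w =>
  .ofKey (fun m => toLex (classW x (e w) (e m), m)) fun _ _ h =>
    congrArg Prod.snd (toLex.injective h)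

/-- The men's lists: sorted by class, ties broken by index. -/
def menProfile (y : Finset (Fin k × Fin k)) : Profile (Fin n) (Fin n) := fun m =>
  .ofKey (fun w => toLex (classM y (e m) (e w), w)) fun _ _ h =>
    congrArg Prod.snd (toLex.injective h)

variable {e} {x y : Finset (Fin k × Fin k)}

/-- A strictly better class is preferred however ties are broken. -/
theorem IsStable.classStable {μ : Fin n ≃ Fin n}
    (h : IsStable (womenProfile e x) (menProfile e y) μ) :
    ClassStable x y ((e.symm.trans μ).trans e) := by
  intro w m h1 h2
  refine h (e.symm w) (e.symm m) ⟨?_, ?_⟩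
  · simp only [womenProfile, PrefList.ofKey, Prod.Lex.toLex_lt_toLex]
    left
    simpa using h1
  · simp only [menProfile, PrefList.ofKey, Prod.Lex.toLex_lt_toLex]
    left
    simpa using h2

/-- A preferred partner is in a weakly better class, so a blocking pair would be a married couple,
but nobody prefers their spouse to their spouse. -/
theorem StrictlyClassStable.isStable {σ : Agent k l ≃ Agent k l}
    (h : StrictlyClassStable x y σ) :
    IsStable (womenProfile e x) (menProfile e y) ((e.trans σ).trans e.symm) := by
  rintro w m ⟨h1, h2⟩
  simp only [womenProfile, menProfile, PrefList.ofKey, Prod.Lex.toLex_lt_toLex] at h1 h2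
  have hw := h (e w) (e m)
    (by
      rcases h1 with h1 | h1
      · simpa using h1.le
      · simpa using h1.1.le)
    (by
      rcases h2 with h2 | h2
      · simpa using h2.le
      · simpa using h2.1.le)
  simp [hw] at h1

/-- `σ` is the unique stable marriage. -/
def UniquelyStable (e : Fin n ≃ Agent k l) (x y : Finset (Fin k × Fin k))
    (σ : Agent k l ≃ Agent k l) : Prop :=
  IsStable (womenProfile e x) (menProfile e y) ((e.trans σ).trans e.symm) ∧
    ∀ μ, IsStable (womenProfile e x) (menProfile e y) μ → μ = (e.trans σ).trans e.symm

theorem eq_of_conj_eq {μ : Fin n ≃ Fin n} {σ : Agent k l ≃ Agent k l}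
    (h : (e.symm.trans μ).trans e = σ) : μ = (e.trans σ).trans e.symm := by
  subst h
  ext; simp

theorem uniquelyStable_refl (h : Disjoint x y) : UniquelyStable e x y (Equiv.refl _) :=
  ⟨(strictlyClassStable_refl h).isStable, fun _ hμ => eq_of_conj_eq (hμ.classStable.eq_refl h)⟩

theorem uniquelyStable_shift {i j : Fin k} (h : x ∩ y = {(i, j)}) :
    UniquelyStable e x y (shift i j) :=
  ⟨(strictlyClassStable_shift h).isStable, fun _ hμ => eq_of_conj_eq (hμ.classStable.eq_shift h)⟩

/-- Together with `UniquelyStable.inEvery_iff`, this makes the two search problems agree on all the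
inputs used by the reduction. -/
theorem UniquelyStable.inSome_iff {σ : Agent k l ≃ Agent k l} (h : UniquelyStable e x y σ)
    (q : Fin n × Fin n) :
    InSomeStable (womenProfile e x) (menProfile e y) q ↔ σ (e q.1) = e q.2 := by
  constructor
  · rintro ⟨μ, hμ, hq⟩
    rw [h.2 μ hμ] at hq
    rw [← hq]; simp
  · exact fun hq => ⟨_, h.1, by simp [hq]⟩

theorem UniquelyStable.inEvery_iff {σ : Agent k l ≃ Agent k l} (h : UniquelyStable e x y σ)
    (q : Fin n × Fin n) :
    InEveryStable (womenProfile e x) (menProfile e y) q ↔ σ (e q.1) = e q.2 := by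
  constructor
  · intro hq
    rw [← hq _ h.1]; simp
  · intro hq μ hμ
    rw [h.2 μ hμ]; simp [hq]

/-- Some pair of the set consists of a woman of the chain and her default partner. -/
def HasChainPair (e : Fin n ≃ Agent k l) (S : Finset (Fin n × Fin n)) : Prop :=
  ∃ q ∈ S, ∃ t, e q.1 = .inr (.inr t) ∧ e q.2 = .inr (.inr t)

/-- A default couple is determined by its woman, and only `2 * k` women lie outside the chain. An
output of more than `2 * k` default couples therefore reveals a chain couple. -/
theorem card_le_of_not_hasChainPair {S : Finset (Fin n × Fin n)} (hS : ∀ q ∈ S, e q.1 = e q.2)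
    (h : ¬ HasChainPair e S) : #S ≤ 2 * k := by
  have : #S ≤ Fintype.card (Fin k ⊕ Fin k) := by
    rw [← Finset.card_univ]
    rw [← Finset.card_map (f := ⟨fun a : Fin k ⊕ Fin k => (Sum.map id Sum.inl a : Agent k l), by
      rintro (a | a) (b | b) <;> simp⟩)]
    refine Finset.card_le_card_of_injOn (fun q => e q.1) ?_ ?_
    · intro q hq
      simp only [Finset.coe_map, Finset.coe_univ, Set.image_univ,
        Set.mem_range]
      rcases hh : e q.1 with i | j | t
      · exact ⟨.inl i, rfl⟩
      · exact ⟨.inr j, rfl⟩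
      · exact absurd ⟨q, hq, t, hh, (hS q hq) ▸ hh⟩ h
    · intro q hq q' hq' hqq
      simp only [EmbeddingLike.apply_eq_iff_eq] at hqq
      have h1 := e.injective (hS q hq)
      have h2 := e.injective (hS q' hq')
      ext1
      · exact hqq
      · rw [← h1, ← h2, hqq]
  simpa [two_mul] using this

/-- A search problem about the market that, whenever there is a unique stable marriage, asks for a
large set of its pairs has communication complexity quadratic in `k`. -/
theorem le_randCC_of_uniquelyStable {ε p : ℝ} (hp : 1 / 2 < p) (hε : ε ≤ 1)
    (hk : (2 * k : ℝ) < ε * n)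
    {R : Profile (Fin n) (Fin n) → Profile (Fin n) (Fin n) → Finset (Fin n × Fin n) → Prop}
    (e : Fin n ≃ Agent k l)
    (hR : ∀ x y σ, UniquelyStable e x y σ → ∀ S, R (womenProfile e x) (menProfile e y) S ↔
      ε * n ≤ (#S : ℝ) ∧ ∀ q ∈ S, σ (e q.1) = e q.2) :
    ENNReal.ofReal ((2 * p - 1) ^ 2 / 64 * k ^ 2) ≤ ((randCC p R : ℕ∞) : ℝ≥0∞) := by
  -- A protocol is only held to inputs that have a correct output; here all `n ≥ ε * n` couples of
  -- the stable marriage form one.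
  have hex : ∀ x y σ, UniquelyStable e x y σ → ∃ S, R (womenProfile e x) (menProfile e y) S := by
    intro x y σ h
    refine ⟨Finset.univ.image fun w => (w, e.symm (σ (e w))), (hR x y σ h _).2 ⟨?_, ?_⟩⟩
    · rw [Finset.card_image_of_injective _ fun a b hab => (Prod.ext_iff.1 hab).1]
      simp only [Finset.card_univ, Fintype.card_fin]
      exact mul_le_of_le_one_left (by positivity) hε
    · simp
  have hmain : ∀ P : RandProtocol _ _ _, P.Solves p R →
      ENNReal.ofReal ((2 * p - 1) ^ 2 / 64 * k ^ 2) ≤ ((P.cost : ℕ∞) : ℝ≥0∞) := by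
    intro P hP
    have := le_cost hp hP (womenProfile e) (menProfile e) (HasChainPair e)
      (fun x y hxy => ⟨hex x y _ (uniquelyStable_refl hxy), fun S hS => by
        obtain ⟨h1, h2⟩ := (hR x y _ (uniquelyStable_refl hxy) S).1 hS
        by_contra hc
        have h3 : (#S : ℝ) ≤ 2 * k := by exact_mod_cast card_le_of_not_hasChainPair h2 hc
        linarith⟩)
      (fun x y ⟨i, j⟩ hxy => ⟨hex x y _ (uniquelyStable_shift hxy), fun S hS => by
        obtain ⟨_, h2⟩ := (hR x y _ (uniquelyStable_shift hxy) S).1 hS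
        rintro ⟨q, hq, t, h3, h4⟩
        have := h2 q hq
        rw [h3, h4] at this
        exact shift_right_ne i j t this⟩)
    simpa [sq] using this
  rw [randCC]
  -- An empty infimum is `⊤`; a nonempty one in `ℕ∞` is attained, so the bound for single protocols
  -- passes to it.
  rcases isEmpty_or_nonempty {P : RandProtocol _ _ _ // P.Solves p R} with he | he
  · have : (⨅ P : RandProtocol _ _ _, ⨅ _ : P.Solves p R, P.cost) = ⊤ := by
      simp only [iInf_eq_top]
      exact fun P hP => (he.false ⟨P, hP⟩).elim
    rw [this]; simp
  · rw [← iInf_subtype (p := fun P : RandProtocol _ _ _ => P.Solves p R) (f := fun P => P.1.cost)]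
    obtain ⟨P, hP⟩ := ciInf_mem (fun P : {P : RandProtocol _ _ _ // P.Solves p R} => P.1.cost)
    rw [← hP]
    exact hmain P.1 P.2

end Market

/-- The search problem is constrained only on reduction inputs with a unique stable marriage, so
that one argument serves both tasks. -/
theorem exists_le_randCC {ε : ℝ} (hε₀ : 0 < ε) (hε₁ : ε ≤ 1) {p : ℝ} (hp : 1 / 2 < p)
    (R : ∀ n : ℕ, Profile (Fin n) (Fin n) → Profile (Fin n) (Fin n) →
      Finset (Fin n × Fin n) → Prop)
    (hR : ∀ (n k l : ℕ) (e : Fin n ≃ Agent k l) x y σ, UniquelyStable e x y σ →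
      ∀ S, R n (womenProfile e x) (menProfile e y) S ↔
        ε * n ≤ (S.card : ℝ) ∧ ∀ q ∈ S, σ (e q.1) = e q.2) :
    ∃ c : ℝ, 0 < c ∧ ∃ N : ℕ, ∀ n : ℕ, N ≤ n →
      ENNReal.ofReal (c * (n : ℝ) ^ 2) ≤ ((randCC p (R n) : ℕ∞) : ℝ≥0∞) := by
  have hγ : 0 < 2 * p - 1 := by linarith
  -- From `ε * n ≥ 8` it follows that `k = ⌊ε * n / 4⌋₊` is at least `ε * n / 8`, while `2 * k < ε *
  -- n` and at least one agent per side remains for the chain.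
  refine ⟨(2 * p - 1) ^ 2 / 64 * (ε / 8) ^ 2, by positivity, ⌈8 / ε⌉₊, fun n hn => ?_⟩
  have hn' : 8 / ε ≤ n := Nat.ceil_le.1 hn
  rw [div_le_iff₀ hε₀] at hn'
  set k := ⌊ε * n / 4⌋₊ with hk
  have hk1 : (k : ℝ) ≤ ε * n / 4 := Nat.floor_le (by positivity)
  have hk2 : ε * n / 4 < k + 1 := Nat.lt_floor_add_one _
  have hn0 : ε * n ≤ n := mul_le_of_le_one_left (by positivity) hε₁
  have hkn : 2 * k + 1 ≤ n := by
    have : (2 * k : ℝ) + 1 ≤ n := by linarith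
    exact_mod_cast this
  obtain ⟨l, hl⟩ := Nat.exists_eq_add_of_le hkn
  have e : Fin n ≃ Agent k l := (Fintype.equivFinOfCardEq (by simp; omega)).symm
  refine le_trans (ENNReal.ofReal_le_ofReal ?_)
    (le_randCC_of_uniquelyStable hp hε₁ (by linarith) e (hR n k l e))
  rw [mul_assoc, ← mul_pow]
  gcongr
  linarith

end StableMarriage

theorem theorem7 (ε : ℝ) (hε₀ : 0 < ε) (hε₁ : ε ≤ 1) (p : ℝ) (hp₀ : 1 / 2 < p) (hp₁ : p ≤ 1) :
    (∃ c : ℝ, 0 < c ∧ ∃ N : ℕ, ∀ n : ℕ, N ≤ n →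
      ENNReal.ofReal (c * (n : ℝ) ^ 2) ≤
        ((StableMarriage.randCC p (StableMarriage.FindSome ε n) : ℕ∞) : ℝ≥0∞)) ∧
    (∃ c : ℝ, 0 < c ∧ ∃ N : ℕ, ∀ n : ℕ, N ≤ n →
      ENNReal.ofReal (c * (n : ℝ) ^ 2) ≤
        ((StableMarriage.randCC p (StableMarriage.FindEvery ε n) : ℕ∞) : ℝ≥0∞)) := by
  constructor
  · refine StableMarriage.exists_le_randCC hε₀ hε₁ hp₀ (fun n => StableMarriage.FindSome ε n) ?_
    intro n k l e x y σ h S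
    simp only [StableMarriage.FindSome, h.inSome_iff]
  · refine StableMarriage.exists_le_randCC hε₀ hε₁ hp₀ (fun n => StableMarriage.FindEvery ε n) ?_
    intro n k l e x y σ h S
    simp only [StableMarriage.FindEvery, h.inEvery_iff]
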